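/- Let $\mathcal A$ be a von Neumann algebra with a finite, normal, faithful trace $\tau$, let $\mathcal A_h$ be the real space of its selfadjoint elements and $\Sigma=e^{\mathcal A_h}$ the set of its positive invertible elements, an open subset of $\mathcal A_h$ for the norm topology. A geodesic of $\Sigma$ (for the Levi-Civita connection of the metric $\langle x,y\rangle_a=\tau(xa^{-1}ya^{-1})$, $a\in\Sigma$, $x,y\in\mathcal A_h$) is a curve $\gamma$ in $\Sigma$, twice continuously differentiable in norm, with $\nabla_{\dot\gamma}\dot\gamma=0$, where $\nabla_{\dot\gamma}Y=\dot Y-\frac12\bigl(\dot\gamma\gamma^{-1}Y+Y\gamma^{-1}\dot\gamma\bigr)$ for a vector field $Y$ along $\gamma$; that is, $\ddot\gamma=\dot\gamma\gamma^{-1}\dot\gamma$. Let $H\subseteq\mathcal A_h$ be a norm-closed real linear subspace, and let $M=e^H=\{e^x:x\in H\}$. Write $[x,y]=xy-yx$. Then the following are equivalent: (i) $M$ is a geodesically convex subset of $\Sigma$: for every geodesic $\gamma:[0,1]\to\Sigma$ with $\gamma(0),\gamma(1)\in M$ one has $\gamma(t)\in M$ for all $t\in[0,1]$; (ii) for every geodesic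 $\gamma:\mathbb R\to\Sigma$ with $\gamma(0),\gamma(1)\in M$ one has $\gamma(t)\in M$ for all $t\in\mathbb R$; (iii) $[x,[x,y]]\in H$ for all $x,y\in H$. -/

import Mathlib

open Set

noncomputable section

namespace PositiveCone

/-- A finite, normal, faithful trace on a von Neumann algebra: a positive, tracial linear
functional, with `τ (x* x) = 0` only for `x = 0`, that preserves suprema of upward directed sets
of positive elements.  No normalization `τ 1 = 1` is required. -/
structure IsFiniteNormalFaithfulTrace {A : Type*} [CStarAlgebra A] [PartialOrder A]
    (τ : A →ₗ[ℂ] ℂ) : Prop where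
  im_eq_zero : ∀ a : A, 0 ≤ a → (τ a).im = 0
  re_nonneg : ∀ a : A, 0 ≤ a → 0 ≤ (τ a).re
  tracial : ∀ x y : A, τ (x * y) = τ (y * x)
  faithful : ∀ x : A, τ (star x * x) = 0 → x = 0
  normal : ∀ D : Set A, D.Nonempty → DirectedOn (· ≤ ·) D → (∀ d ∈ D, 0 ≤ d) →
    ∀ a : A, IsLUB D a → IsLUB ((fun d => (τ d).re) '' D) (τ a).re

/-- The space `Σ` of positive invertible elements. -/
def posInv (A : Type*) [CStarAlgebra A] [PartialOrder A] : Set A :=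
  {a : A | IsUnit a ∧ 0 ≤ a}

/-- The covariant derivative `DY/dt = Y' - (1/2) (γ' γ⁻¹ Y + Y γ⁻¹ γ')` at time `t` of a vector
field `Y` along a curve `γ` in `Σ` with parameter interval `I`.  It belongs to the Levi-Civita
connection of the trace metric `⟨x, y⟩_a = τ (x a⁻¹ y a⁻¹)`. -/
def covariantDeriv {A : Type*} [CStarAlgebra A] (I : Set ℝ) (γ Y : ℝ → A) (t : ℝ) : A :=
  derivWithin Y I t -
    (2⁻¹ : ℝ) • (derivWithin γ I t * Ring.inverse (γ t) * Y t +
      Y t * Ring.inverse (γ t) * derivWithin γ I t)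

/-- A geodesic of `Σ` with parameter interval `I`: a curve in `Σ`, twice continuously
differentiable for the norm, whose velocity field is parallel along it. -/
structure IsGeodesicOn {A : Type*} [CStarAlgebra A] [PartialOrder A]
    (I : Set ℝ) (γ : ℝ → A) : Prop where
  mapsTo : MapsTo γ I (posInv A)
  contDiffOn : ContDiffOn ℝ 2 γ I
  euler : ∀ t ∈ I, covariantDeriv I γ (derivWithin γ I) t = 0

/-- `M` is a geodesically convex subset of `Σ`: every geodesic segment of `Σ` that joins two
points of `M` stays in `M`. -/
def IsGeodesicallyConvex {A : Type*} [CStarAlgebra A] [PartialOrder A] (M : Set A) : Prop :=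
  M ⊆ posInv A ∧ ∀ p ∈ M, ∀ q ∈ M, ∀ γ : ℝ → A, IsGeodesicOn (Icc 0 1) γ →
    γ 0 = p → γ 1 = q → ∀ t ∈ Icc (0 : ℝ) 1, γ t ∈ M

/-- `M` is a subset of `Σ` such that every complete geodesic `γ : ℝ → Σ` with `γ 0` and `γ 1`
in `M` stays in `M` for every real value of the parameter. -/
def ContainsCompleteGeodesics {A : Type*} [CStarAlgebra A] [PartialOrder A] (M : Set A) : Prop :=
  M ⊆ posInv A ∧ ∀ p ∈ M, ∀ q ∈ M, ∀ γ : ℝ → A, IsGeodesicOn univ γ →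
    γ 0 = p → γ 1 = q → ∀ t : ℝ, γ t ∈ M

end PositiveCone

end

open Set
open scoped Topology

/-! Geodesics of `Σ` are the curves `t ↦ e^(x/2) e^(tv) e^(x/2)`. If `H` is a Lie triple system,
everything reduces to one stability property: `e^x e^y e^x ∈ e^H` for `x, y ∈ H`
(`IsLieTripleSystem.exp_mul_exp_mul_exp_mem`). Applied to the endpoints of a geodesic it puts `v` in
`H`, since `exp` is injective on selfadjoint elements; applied again it puts every point of the
geodesic in `e^H`.

Stability comes from an ODE inside `H`. A curve `w` with `e^(w(s)) = e^(sx) e^y e^(sx)` must satisfy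
`S_w w' = 2 cosh(ad w / 2) x`, where `S_w = sinh(ad w / 2) / (ad w / 2)` is the derivative of `exp`
at `w` stripped of a factor `e^(w/2)` on each side. Both operators are even in `ad w`, hence
preserve `H`. Moreover `S_w` is the infinite product of `cosh(ad w / 2^n)`, `n ≥ 2`, and `cosh(ad
u)`, `u` selfadjoint, never decreases the norm of a selfadjoint element (`norm_le_norm_cosh_adL`).
So `S_w` is bounded below on `H`, and deforming `w` to `0` shows that it is invertible there
(`IsLieTripleSystem.exists_symDexp_eq`). Picard–Lindelöf gives `w` for short times, and a
connectedness argument for all times.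

Conversely, let `w(s) ∈ H` be the logarithm of the midpoint of the geodesic from `e^(sx)` to
`e^(sy)`. It solves `e^w e^(-sx) e^w = e^(sy)`, and its cubic Taylor coefficient is `([y,[x,y]] -
[x,[x,y]]) / 48`, which lies in `H` because `H` is closed (`lie_sub_lie_mem_of_riccati`). The two
terms have different degrees in `x`, so rescaling `x` separates them. -/

namespace PositiveCone

open NormedSpace

/-! ### Exponentials in a Banach algebra and even functions of `ad w` -/

section Exp

variable {B : Type*} [NormedRing B] [NormedAlgebra ℝ B]

/-- The commutator `[w, ·]` as a bounded operator. -/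
noncomputable def adL (w : B) : B →L[ℝ] B :=
  ContinuousLinearMap.mul ℝ B w - (ContinuousLinearMap.mul ℝ B).flip w

@[simp] theorem adL_apply (w h : B) : adL w h = w * h - h * w := rfl

variable [CompleteSpace B]

theorem exp_mul_exp_neg (x : B) : exp x * exp (-x) = 1 := by
  let := NormedAlgebra.restrictScalars ℚ ℝ B
  rw [← exp_add_of_commute (Commute.neg_right (Commute.refl x)), add_neg_cancel, exp_zero]

theorem exp_neg_mul_exp (x : B) : exp (-x) * exp x = 1 := by
  simpa using exp_mul_exp_neg (-x)

theorem exp_half_mul_exp_half (x : B) : exp ((2⁻¹ : ℝ) • x) * exp ((2⁻¹ : ℝ) • x) = exp x := by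
  let := NormedAlgebra.restrictScalars ℚ ℝ B
  rw [← exp_add_of_commute (Commute.refl _), ← add_smul]
  norm_num

theorem continuous_exp : Continuous (exp : B → B) := by
  let := NormedAlgebra.restrictScalars ℚ ℝ B
  exact exp_continuous

theorem exp_add_smul (s t : ℝ) (x : B) : exp ((s + t) • x) = exp (s • x) * exp (t • x) := by
  let := NormedAlgebra.restrictScalars ℚ ℝ B
  rw [add_smul, exp_add_of_commute (((Commute.refl x).smul_left s).smul_right t)]

theorem contDiff_exp {n : WithTop ℕ∞} : ContDiff ℝ n (exp : B → B) :=
  contDiff_iff_contDiffAt.2 fun x => (exp_analytic x).contDiffAt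

theorem isUnit_exp' (x : B) : IsUnit (exp x) :=
  ⟨⟨exp x, exp (-x), exp_mul_exp_neg x, exp_neg_mul_exp x⟩, rfl⟩

/-- Undoing the flow of `ad w` by conjugation with `e^(tw)` gives a curve with zero derivative. -/
theorem exp_conj_eq_exp_adL (w h : B) : exp w * h * exp (-w) = exp (adL w) h := by
  have key : ∀ t : ℝ, exp (t • (-w)) * (exp (t • adL w) h) * exp (t • w) = h := by
    intro t
    have hf : ∀ t, HasDerivAt
        (fun t : ℝ => exp (t • (-w)) * (exp (t • adL w) h) * exp (t • w)) 0 t := by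
      intro t
      have h1 := hasDerivAt_exp_smul_const (𝕂 := ℝ) (-w) t
      have h2 := (hasDerivAt_exp_smul_const' (𝕂 := ℝ) (adL w) t).clm_apply
        (hasDerivAt_const t h)
      have h3 := hasDerivAt_exp_smul_const' (𝕂 := ℝ) w t
      refine ((h1.mul h2).mul h3).congr_deriv ?_
      simp only [map_zero, add_zero, mul_apply_eq_comp, adL_apply, Pi.mul_apply]
      noncomm_ring
    have hc := is_const_of_deriv_eq_zero (fun t => (hf t).differentiableAt)
      (fun t => (hf t).deriv) t 0
    simp only [zero_smul, exp_zero, mul_one, one_mul] at hc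
    have h0 : exp ((0 : ℝ) • adL w) h = h := by
      rw [show (0 : ℝ) • adL w = 0 from ContinuousLinearMap.ext fun v => zero_smul ℝ _,
        exp_zero]; rfl
    exact hc.trans h0
  have h1 := key 1
  simp only [one_smul] at h1
  calc exp w * h * exp (-w)
      = (exp w * exp (-w)) * (exp (adL w) h) * (exp w * exp (-w)) := by
        nth_rewrite 1 [← h1]; noncomm_ring
    _ = exp (adL w) h := by simp [exp_mul_exp_neg]

/-- In `e^(ad w) + e^(-ad w)` the odd powers cancel, and the even ones are iterates of the double
bracket with `w`, so every partial sum stays in `H`. -/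
theorem cosh_adL_mem (H : Submodule ℝ B) (hclosed : IsClosed (H : Set B))
    {w h : B} (hw : ∀ k ∈ H, ⁅w, ⁅w, k⁆⁆ ∈ H) (hh : h ∈ H) :
    exp w * h * exp (-w) + exp (-w) * h * exp w ∈ H := by
  have h2 : exp (-w) * h * exp w = exp (-adL w) h := by
    have := exp_conj_eq_exp_adL (-w) h
    rw [neg_neg] at this
    rw [this]
    congr 2
    ext; simp; abel
  rw [exp_conj_eq_exp_adL, h2]
  have hs (T : B →L[ℝ] B) : HasSum (fun n : ℕ => ((n.factorial : ℝ)⁻¹ • T ^ n) h) (exp T h) :=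
    (exp_series_hasSum_exp' (𝕂 := ℝ) T).mapL (ContinuousLinearMap.apply ℝ B h)
  have hsum := (hs (adL w)).add (hs (-adL w))
  have hsq : ∀ n : ℕ, ((adL w) ^ (2 * n)) h ∈ H := by
    intro n
    induction n with
    | zero => simpa using hh
    | succ n ih =>
      rw [mul_add, mul_one, add_comm, pow_add]
      simpa [pow_two, Ring.lie_def] using hw _ ih
  refine hclosed.mem_of_tendsto hsum (Filter.Eventually.of_forall fun s => ?_)
  refine H.sum_mem fun n _ => ?_
  simp only [smul_apply]
  rw [← smul_add]
  refine H.smul_mem _ ?_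
  rcases Nat.even_or_odd n with he | ho
  · obtain ⟨m, rfl⟩ := even_iff_two_dvd.1 he
    rw [show (-adL w) ^ (2 * m) = adL w ^ (2 * m) from Even.neg_pow he (adL w)]
    exact H.add_mem (hsq m) (hsq m)
  · rw [show (-adL w) ^ n = -adL w ^ n from Odd.neg_pow ho (adL w)]
    simp

end Exp

/-! ### A lower bound for `cosh (ad x)` on selfadjoint elements -/

section CStar

variable {A : Type*} [CStarAlgebra A]

theorem isSelfAdjoint_exp {x : A} (hx : IsSelfAdjoint x) : IsSelfAdjoint (exp x) := by
  rw [isSelfAdjoint_iff, star_exp, hx.star_eq]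

variable [PartialOrder A] [StarOrderedRing A]

/-- An element whose real part is bounded below by a positive scalar is invertible. -/
theorem isUnit_of_algebraMap_le_add_star {c : A} {ε : ℝ} (hε : 0 < ε)
    (h : algebraMap ℝ A ε ≤ c + star c) : IsUnit c := by
  set M : ℝ := ‖c‖ ^ 2 with hM
  have hM0 : 0 ≤ M := by positivity
  -- Chosen so that `t² M ≤ t ε / 2`, which gives `‖1 - t c‖² ≤ 1 - t ε / 2 < 1` and makes `t c`
  -- invertible by the Neumann series.
  set t : ℝ := ε / (2 * (M + 1)) with ht
  have ht0 : 0 < t := by positivity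
  have htM : t * M ≤ ε / 2 := by
    rw [ht, div_mul_eq_mul_div, div_le_div_iff₀ (by positivity) (by positivity)]
    nlinarith
  set r : ℝ := max 0 (1 - t * ε / 2) with hr
  have hr1 : r < 1 := max_lt one_pos (by have : 0 < t * ε := by positivity
                                         linarith)
  have hle : star (1 - t • c) * (1 - t • c) ≤ algebraMap ℝ A r := by
    have e : star (1 - t • c) * (1 - t • c) =
        1 - t • (c + star c) + (t ^ 2) • (star c * c) := by
      simp only [star_sub, star_one, star_smul, star_trivial, sub_mul, mul_sub, one_mul, mul_one,
        smul_mul_smul_comm, smul_add, pow_two]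
      abel
    have h1 : t • algebraMap ℝ A ε ≤ t • (c + star c) := smul_le_smul_of_nonneg_left h ht0.le
    have h2 : t ^ 2 • (star c * c) ≤ t ^ 2 • algebraMap ℝ A M :=
      smul_le_smul_of_nonneg_left CStarAlgebra.star_mul_le_algebraMap_norm_sq (by positivity)
    calc star (1 - t • c) * (1 - t • c)
        = 1 - t • (c + star c) + (t ^ 2) • (star c * c) := e
      _ ≤ 1 - t • algebraMap ℝ A ε + t ^ 2 • algebraMap ℝ A M := by gcongr
      _ = algebraMap ℝ A (1 - t * ε + t ^ 2 * M) := by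
          simp [Algebra.smul_def]
      _ ≤ algebraMap ℝ A r := by
          refine algebraMap_mono A (le_trans ?_ (le_max_right _ _))
          nlinarith
  have hn : ‖1 - t • c‖ < 1 := by
    have h3 := (CStarAlgebra.norm_le_iff_le_algebraMap _ (le_max_left _ _)
      (star_mul_self_nonneg (1 - t • c))).2 hle
    rw [CStarRing.norm_star_mul_self] at h3
    nlinarith [norm_nonneg (1 - t • c)]
  have hu : IsUnit (t • c) := by
    have := isUnit_one_sub_of_norm_lt_one hn
    rwa [sub_sub_cancel] at this
  rwa [← isUnit_smul_iff (Units.mk0 t ht0.ne') c] 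

/-- The right side is the norm of the real part `P` of `c = e^x k e^(-x)`, and `c` has the spectrum
of `k`, which contains `‖k‖` or `-‖k‖`. If `‖P‖ < ‖k‖`, then `‖k‖ - c` and `c + ‖k‖` have real part
bounded below by `‖k‖ - ‖P‖ > 0`, so both are invertible, a contradiction. -/
theorem norm_le_norm_cosh_adL {x k : A} (hx : IsSelfAdjoint x) (hk : IsSelfAdjoint k) :
    ‖k‖ ≤ ‖(2⁻¹ : ℝ) • (exp x * k * exp (-x) + exp (-x) * k * exp x)‖ := by
  nontriviality A
  set P := (2⁻¹ : ℝ) • (exp x * k * exp (-x) + exp (-x) * k * exp x) with hP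
  by_contra! hlt
  have hsE := (isSelfAdjoint_exp hx).star_eq
  have hsE' := (isSelfAdjoint_exp hx.neg).star_eq
  have hPs : IsSelfAdjoint P := by
    rw [isSelfAdjoint_iff, hP]
    simp only [star_smul, star_trivial, star_add, star_mul, hsE, hsE', hk.star_eq, mul_assoc]
    rw [add_comm]
  have h2P : P + P = exp x * k * exp (-x) + exp (-x) * k * exp x := by
    rw [hP, ← add_smul]; norm_num
  have hstar : star (exp x * k * exp (-x)) = exp (-x) * k * exp x := by
    simp [star_mul, hsE, hsE', hk.star_eq, mul_assoc]
  -- the spectrum of `k` is that of its conjugate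
  have hconj : ∀ d : A, IsUnit (exp x * d * exp (-x)) → IsUnit d := by
    intro d hd
    have := ((isUnit_exp' (-x)).mul hd).mul (isUnit_exp' x)
    have e : exp (-x) * (exp x * d * exp (-x)) * exp x =
        (exp (-x) * exp x) * d * (exp (-x) * exp x) := by noncomm_ring
    rwa [e, exp_neg_mul_exp, one_mul, mul_one] at this
  have hlam : ∀ r : ℝ, exp x * algebraMap ℝ A r * exp (-x) = algebraMap ℝ A r := by
    intro r
    rw [← Algebra.commutes, mul_assoc, exp_mul_exp_neg, mul_one]
  have hpos : 0 < 2 * (‖k‖ - ‖P‖) := by linarith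
  have e2 : ∀ r : ℝ, algebraMap ℝ A (2 * r) = algebraMap ℝ A r + algebraMap ℝ A r := by
    intro r; rw [two_mul, map_add]
  have hsr : ∀ r : ℝ, star (algebraMap ℝ A r) = algebraMap ℝ A r := by
    intro r; rw [← algebraMap_star_comm]; rfl
  rcases CStarAlgebra.norm_or_neg_norm_mem_spectrum hk with h | h
  · refine h (hconj _ (isUnit_of_algebraMap_le_add_star hpos ?_))
    rw [e2, map_sub, mul_sub, sub_mul, hlam, star_sub, hstar, hsr]
    have : algebraMap ℝ A ‖k‖ - exp x * k * exp (-x) +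
        (algebraMap ℝ A ‖k‖ - exp (-x) * k * exp x) =
        algebraMap ℝ A ‖k‖ + algebraMap ℝ A ‖k‖ - (P + P) := by rw [h2P]; abel
    rw [this]
    have hle := hPs.le_algebraMap_norm_self
    calc _ = algebraMap ℝ A ‖k‖ + algebraMap ℝ A ‖k‖ -
          (algebraMap ℝ A ‖P‖ + algebraMap ℝ A ‖P‖) := by abel
      _ ≤ _ := by gcongr
  · refine h (IsUnit.neg_iff _ |>.1 (hconj _ (isUnit_of_algebraMap_le_add_star hpos ?_)))
    rw [e2, neg_sub, map_sub, mul_sub, sub_mul, hlam, star_sub, hstar, hsr, map_neg]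
    have : exp x * k * exp (-x) - -algebraMap ℝ A ‖k‖ +
        (exp (-x) * k * exp x - -algebraMap ℝ A ‖k‖) =
        algebraMap ℝ A ‖k‖ + algebraMap ℝ A ‖k‖ + (P + P) := by rw [h2P]; abel
    rw [this]
    have hle := hPs.neg_algebraMap_norm_le_self
    calc _ = algebraMap ℝ A ‖k‖ + algebraMap ℝ A ‖k‖ +
          (-algebraMap ℝ A ‖P‖ + -algebraMap ℝ A ‖P‖) := by abel
      _ ≤ _ := by gcongr

end CStar

/-! ### The symmetrized derivative of the exponential -/

section SymmetrizedDerivative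

variable {B : Type*} [NormedRing B] [NormedAlgebra ℝ B]

/-- The operator `h ↦ exp (-w/2) * D exp_w (h) * exp (-w/2)`, i.e. `sinh (ad w / 2) / (ad w / 2)`. -/
noncomputable def symDexp (w : B) : B →L[ℝ] B :=
  (ContinuousLinearMap.mulLeftRight ℝ B (exp (-((2⁻¹ : ℝ) • w))) (exp (-((2⁻¹ : ℝ) • w)))) ∘L
    fderiv ℝ exp w

theorem symDexp_apply (w h : B) : symDexp w h =
    exp (-((2⁻¹ : ℝ) • w)) * fderiv ℝ exp w h * exp (-((2⁻¹ : ℝ) • w)) := rfl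

/-- The operator `cosh (ad w)`. -/
noncomputable def coshAd (w h : B) : B :=
  (2⁻¹ : ℝ) • (exp w * h * exp (-w) + exp (-w) * h * exp w)

theorem coshAd_sub (w h k : B) : coshAd w (h - k) = coshAd w h - coshAd w k := by
  simp only [coshAd, ← smul_sub]
  congr 1
  noncomm_ring

theorem lie_lie_smul_mem (H : Submodule ℝ B) {w : B} (hw : ∀ k ∈ H, ⁅w, ⁅w, k⁆⁆ ∈ H) (r : ℝ) :
    ∀ k ∈ H, ⁅r • w, ⁅r • w, k⁆⁆ ∈ H := fun k hk => by
  have e : ⁅r • w, ⁅r • w, k⁆⁆ = r • r • ⁅w, ⁅w, k⁆⁆ := by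
    simp only [Ring.lie_def, smul_mul_assoc, mul_smul_comm, ← smul_sub]
  rw [e]
  exact H.smul_mem _ (H.smul_mem _ (hw k hk))

variable [CompleteSpace B]

theorem fderiv_exp_eq (w h : B) : fderiv ℝ exp w h =
    exp ((2⁻¹ : ℝ) • w) * symDexp w h * exp ((2⁻¹ : ℝ) • w) := by
  rw [symDexp_apply]
  calc fderiv ℝ exp w h = 1 * fderiv ℝ exp w h * 1 := by simp
    _ = _ := by
      nth_rewrite 1 [← exp_mul_exp_neg ((2⁻¹ : ℝ) • w)]
      rw [← exp_neg_mul_exp ((2⁻¹ : ℝ) • w)]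
      noncomm_ring

theorem hasFDerivAt_exp' (w : B) : HasFDerivAt (exp : B → B) (fderiv ℝ exp w) w :=
  ((contDiff_exp (n := 1)).differentiable one_ne_zero w).hasFDerivAt

theorem contDiff_symDexp : ContDiff ℝ 1 (symDexp : B → B →L[ℝ] B) := by
  have h1 : ContDiff ℝ 1 (fun w : B => exp (-((2⁻¹ : ℝ) • w))) :=
    contDiff_exp.comp (contDiff_id.const_smul _).neg
  have h2 : ContDiff ℝ 1 (fderiv ℝ (exp : B → B)) :=
    (contDiff_exp (n := 2)).fderiv_right (by norm_num)
  have h3 : ContDiff ℝ 1 (fun w : B => ContinuousLinearMap.mulLeftRight ℝ B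
      (exp (-((2⁻¹ : ℝ) • w))) (exp (-((2⁻¹ : ℝ) • w)))) := by
    have h4 : ContDiff ℝ 1 (ContinuousLinearMap.mulLeftRight ℝ B : B → B →L[ℝ] B →L[ℝ] B) :=
      ContinuousLinearMap.contDiff _
    exact (h4.comp h1).clm_apply h1
  exact h3.clm_comp h2

theorem symDexp_zero : symDexp (0 : B) = 1 := by
  ext h
  rw [symDexp_apply, (hasFDerivAt_exp_zero (𝕂 := ℝ) (𝔸 := B)).fderiv]
  simp

/-- This is `sinh 2a = 2 sinh a cosh a` for `a = ad w / 4`, obtained by differentiating `e^w =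
e^(w/2) e^(w/2)`. Iterating it gives the product of hyperbolic cosines. -/
theorem symDexp_eq_coshAd (w h : B) :
    symDexp w h = coshAd ((4⁻¹ : ℝ) • w) (symDexp ((2⁻¹ : ℝ) • w) h) := by
  set u : B := (4⁻¹ : ℝ) • w with hu
  have hu2 : (2⁻¹ : ℝ) • ((2⁻¹ : ℝ) • w) = u := by rw [hu, smul_smul]; norm_num
  have hd0 : HasFDerivAt (fun v : B => (2⁻¹ : ℝ) • v)
      ((2⁻¹ : ℝ) • ContinuousLinearMap.id ℝ B) w :=
    ((2⁻¹ : ℝ) • ContinuousLinearMap.id ℝ B).hasFDerivAt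
  have hd : HasFDerivAt (fun v : B => exp ((2⁻¹ : ℝ) • v))
      (fderiv ℝ exp ((2⁻¹ : ℝ) • w) ∘L ((2⁻¹ : ℝ) • ContinuousLinearMap.id ℝ B)) w :=
    HasFDerivAt.comp (f := fun v : B => (2⁻¹ : ℝ) • v) w (hasFDerivAt_exp' ((2⁻¹ : ℝ) • w)) hd0
  have h2 := hd.mul' hd
  rw [show (fun v : B => exp ((2⁻¹ : ℝ) • v)) * (fun v : B => exp ((2⁻¹ : ℝ) • v)) = exp from
      funext exp_half_mul_exp_half] at h2
  have h3 := congrArg (fun T : B →L[ℝ] B => T h) h2.fderiv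
  simp only [add_apply, smul_apply, ContinuousLinearMap.comp_apply, map_smul, smul_eq_mul,
    ContinuousLinearMap.id_apply, MulOpposite.smul_eq_mul_unop, MulOpposite.unop_op] at h3
  rw [symDexp_apply, h3, fderiv_exp_eq ((2⁻¹ : ℝ) • w) h, hu2, coshAd]
  have e1 : exp (-((2⁻¹ : ℝ) • w)) = exp (-u) * exp (-u) := by
    rw [← exp_half_mul_exp_half, ← hu2, smul_neg]
  have e2 : exp ((2⁻¹ : ℝ) • w) = exp u * exp u := by
    rw [← exp_half_mul_exp_half, ← hu2]
  rw [e1, e2]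
  have a1 := exp_mul_exp_neg u
  have a2 := exp_neg_mul_exp u
  set p := exp u
  set q := exp (-u)
  set d := symDexp ((2⁻¹ : ℝ) • w) h
  have a3 : ∀ z, p * (q * z) = z := fun z => by rw [← mul_assoc, a1, one_mul]
  have a4 : ∀ z, q * (p * z) = z := fun z => by rw [← mul_assoc, a2, one_mul]
  simp only [mul_add, add_mul, mul_assoc, smul_add, mul_smul_comm, smul_mul_assoc, a3, a4, a1,
    mul_one]

theorem norm_exp_le [NormOneClass B] (x : B) : ‖exp x‖ ≤ Real.exp ‖x‖ := by
  have h1 := exp_series_hasSum_exp' (𝕂 := ℝ) x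
  have h2 := exp_series_hasSum_exp' (𝕂 := ℝ) ‖x‖
  rw [← Real.exp_eq_exp_ℝ] at h2
  rw [← h1.tsum_eq]
  refine tsum_of_norm_bounded h2 fun n => ?_
  rw [norm_smul, smul_eq_mul, norm_inv, RCLike.norm_natCast]
  gcongr
  exact norm_pow_le x n

theorem norm_coshAd_le [NormOneClass B] (w h : B) : ‖coshAd w h‖ ≤ Real.exp (2 * ‖w‖) * ‖h‖ := by
  have h1 := norm_exp_le w
  have h2 := norm_exp_le (-w)
  rw [norm_neg] at h2
  have e : Real.exp (2 * ‖w‖) = Real.exp ‖w‖ * Real.exp ‖w‖ := by rw [← Real.exp_add, two_mul]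
  have b1 : ‖exp w * h * exp (-w)‖ ≤ Real.exp (2 * ‖w‖) * ‖h‖ := by
    calc _ ≤ ‖exp w‖ * ‖h‖ * ‖exp (-w)‖ := norm_mul₃_le
      _ ≤ Real.exp ‖w‖ * ‖h‖ * Real.exp ‖w‖ := by gcongr
      _ = _ := by rw [e]; ring
  have b2 : ‖exp (-w) * h * exp w‖ ≤ Real.exp (2 * ‖w‖) * ‖h‖ := by
    calc _ ≤ ‖exp (-w)‖ * ‖h‖ * ‖exp w‖ := norm_mul₃_le
      _ ≤ Real.exp ‖w‖ * ‖h‖ * Real.exp ‖w‖ := by gcongr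
      _ = _ := by rw [e]; ring
  rw [coshAd, norm_smul]
  have := norm_add_le (exp w * h * exp (-w)) (exp (-w) * h * exp w)
  norm_num
  linarith

theorem coshAd_mem (H : Submodule ℝ B) (hclosed : IsClosed (H : Set B))
    {w h : B} (hw : ∀ k ∈ H, ⁅w, ⁅w, k⁆⁆ ∈ H) (hh : h ∈ H) : coshAd w h ∈ H :=
  H.smul_mem _ (cosh_adL_mem H hclosed hw hh)

/-- The witness is the product of the first `n` factors `cosh` applied to `h`. The factor `e^‖w‖`
does not depend on `n`: the outer `cosh` costs `e^(‖w‖/2)` and the remaining ones, taken at `w/2`,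
cost another `e^(‖w‖/2)`. -/
theorem exists_mem_norm_symDexp_sub_le [NormOneClass B] (H : Submodule ℝ B)
    (hclosed : IsClosed (H : Set B)) {h : B} (hh : h ∈ H) (n : ℕ) :
    ∀ w : B, (∀ k ∈ H, ⁅w, ⁅w, k⁆⁆ ∈ H) → ∃ k ∈ H,
      ‖symDexp w h - k‖ ≤ Real.exp ‖w‖ * ‖symDexp (((2⁻¹ : ℝ) ^ n) • w) h - h‖ := by
  induction n with
  | zero =>
    intro w _
    refine ⟨h, hh, ?_⟩
    rw [pow_zero, one_smul]
    exact le_mul_of_one_le_left (norm_nonneg _) (Real.one_le_exp (norm_nonneg _))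
  | succ n ih =>
    intro w hw
    obtain ⟨k, hk, hle⟩ := ih ((2⁻¹ : ℝ) • w) (lie_lie_smul_mem H hw _)
    refine ⟨coshAd ((4⁻¹ : ℝ) • w) k, coshAd_mem H hclosed (lie_lie_smul_mem H hw _) hk, ?_⟩
    rw [symDexp_eq_coshAd, ← coshAd_sub]
    refine (norm_coshAd_le _ _).trans ?_
    rw [smul_smul, ← pow_succ] at hle
    refine (mul_le_mul_of_nonneg_left hle (Real.exp_pos _).le).trans_eq ?_
    rw [← mul_assoc, ← Real.exp_add, norm_smul, norm_smul]
    norm_num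
    left
    ring

theorem tendsto_symDexp_pow_smul (w h : B) :
    Filter.Tendsto (fun n : ℕ => symDexp (((2⁻¹ : ℝ) ^ n) • w) h) Filter.atTop (𝓝 h) := by
  have h1 : Filter.Tendsto (fun n : ℕ => ((2⁻¹ : ℝ) ^ n) • w) Filter.atTop (𝓝 0) := by
    have := (tendsto_pow_atTop_nhds_zero_of_lt_one (r := (2⁻¹ : ℝ)) (by norm_num)
      (by norm_num)).smul_const w
    rwa [zero_smul] at this
  have hc : Continuous fun v : B => symDexp v h :=
    (contDiff_symDexp (B := B)).continuous.clm_apply continuous_const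
  have h2 := (hc.tendsto 0).comp h1
  simpa [symDexp_zero, Function.comp_def] using h2

theorem symDexp_mem [NormOneClass B] (H : Submodule ℝ B) (hclosed : IsClosed (H : Set B))
    {w h : B} (hw : ∀ k ∈ H, ⁅w, ⁅w, k⁆⁆ ∈ H) (hh : h ∈ H) : symDexp w h ∈ H := by
  choose k hk hle using fun n => exists_mem_norm_symDexp_sub_le H hclosed hh n w hw
  refine hclosed.mem_of_tendsto (f := k) (b := Filter.atTop) ?_ (Filter.Eventually.of_forall hk)
  have h1 : Filter.Tendsto (fun n : ℕ => Real.exp ‖w‖ * ‖symDexp (((2⁻¹ : ℝ) ^ n) • w) h - h‖)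
      Filter.atTop (𝓝 0) := by
    have := (((tendsto_symDexp_pow_smul w h).sub_const h).norm).const_mul (Real.exp ‖w‖)
    simpa using this
  rw [tendsto_iff_norm_sub_tendsto_zero]
  refine squeeze_zero (fun _ => norm_nonneg _) (fun n => ?_) h1
  rw [norm_sub_rev]
  exact hle n

end SymmetrizedDerivative

/-! ### Inverting the symmetrized derivative on a Lie triple system -/

theorem isUnit_of_continuous_of_norm_le {E : Type*} [NormedAddCommGroup E] [NormedSpace ℝ E]
    [CompleteSpace E] {T : ℝ → E →L[ℝ] E} (hT : Continuous T) (h0 : T 0 = 1)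
    (hb : ∀ s v, ‖v‖ ≤ ‖T s v‖) (s : ℝ) : IsUnit (T s) := by
  rcases subsingleton_or_nontrivial E with hE | hE
  · rw [show T s = 1 from ContinuousLinearMap.ext fun v => Subsingleton.elim _ _]
    exact isUnit_one
  have hclopen : IsClopen {s | IsUnit (T s)} := by
    refine ⟨?_, Units.isOpen.preimage hT⟩
    rw [← closure_subset_iff_isClosed]
    intro t ht
    have hn : ∀ᶠ r in 𝓝 t, ‖T t - T r‖ < 1 := by
      have : Filter.Tendsto (fun r => ‖T t - T r‖) (𝓝 t) (𝓝 0) := by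
        have := ((hT.tendsto t).const_sub (T t)).norm
        simpa using this
      exact this.eventually (gt_mem_nhds one_pos)
    obtain ⟨r, hr, hru⟩ := (mem_closure_iff_frequently.1 ht).and_eventually hn |>.exists
    obtain ⟨u, hu⟩ := hr
    -- By `hb` every inverse is a contraction, so all operators within distance `1` of `T r` are
    -- invertible, uniformly in `r`. This gives closedness.
    have hinv : ‖((u⁻¹ : (E →L[ℝ] E)ˣ) : E →L[ℝ] E)‖ ≤ 1 := by
      refine ContinuousLinearMap.opNorm_le_bound _ zero_le_one fun v => ?_
      have h1 := hb r ((u⁻¹ : (E →L[ℝ] E)ˣ).val v)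
      rw [← hu] at h1
      have h2 : u.val ((u⁻¹ : (E →L[ℝ] E)ˣ).val v) = v :=
        congrArg (fun S : E →L[ℝ] E => S v) u.mul_inv
      rw [h2] at h1
      simpa using h1
    have hpos : 0 < ‖((u⁻¹ : (E →L[ℝ] E)ˣ) : E →L[ℝ] E)‖ := Units.norm_pos _
    refine ⟨Units.ofNearby u (T t) ?_, rfl⟩
    rw [hu]
    exact hru.trans_le ((one_le_inv₀ hpos).2 hinv)
  have h : s ∈ {s | IsUnit (T s)} := by
    rw [hclopen.eq_univ ⟨0, by simp [h0]⟩]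
    trivial
  exact h

section CStar

variable {A : Type*} [CStarAlgebra A]

variable (H : Submodule ℝ A)

/-- Closed subspaces of selfadjoint elements that are Lie triple systems. -/
structure IsLieTripleSystem : Prop where
  isSelfAdjoint : ∀ x ∈ H, IsSelfAdjoint x
  isClosed : IsClosed (H : Set A)
  lie_lie_mem : ∀ x ∈ H, ∀ y ∈ H, ⁅x, ⁅x, y⁆⁆ ∈ H

namespace IsLieTripleSystem

variable {H}

theorem symDexp_mem (hH : IsLieTripleSystem H) {w h : A} (hw : w ∈ H) (hh : h ∈ H) :
    symDexp w h ∈ H := by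
  rcases subsingleton_or_nontrivial A with hA | hA
  · rw [Subsingleton.elim (symDexp w h) h]
    exact hh
  · exact PositiveCone.symDexp_mem H hH.isClosed (hH.lie_lie_mem w hw) hh

theorem coshAd_mem (hH : IsLieTripleSystem H) {w h : A} (hw : w ∈ H) (hh : h ∈ H) :
    coshAd w h ∈ H :=
  PositiveCone.coshAd_mem H hH.isClosed (hH.lie_lie_mem w hw) hh

variable [PartialOrder A] [StarOrderedRing A]

/-- Each halving of `w` drops one factor `cosh`, which cannot increase the norm. As `n → ∞` the left
side tends to `‖h‖`. -/
theorem norm_symDexp_pow_smul_le (hH : IsLieTripleSystem H) {h : A} (hh : h ∈ H) (n : ℕ) :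
    ∀ w ∈ H, ‖symDexp (((2⁻¹ : ℝ) ^ n) • w) h‖ ≤ ‖symDexp w h‖ := by
  induction n with
  | zero => intro w _; simp
  | succ n ih =>
    intro w hw
    have hw2 := H.smul_mem (2⁻¹ : ℝ) hw
    have h1 := ih _ hw2
    rw [smul_smul, ← pow_succ] at h1
    refine h1.trans ?_
    rw [symDexp_eq_coshAd w]
    exact norm_le_norm_cosh_adL (hH.isSelfAdjoint _ (H.smul_mem _ hw))
      (hH.isSelfAdjoint _ (hH.symDexp_mem hw2 hh))

theorem norm_le_norm_symDexp (hH : IsLieTripleSystem H) {w h : A} (hw : w ∈ H) (hh : h ∈ H) :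
    ‖h‖ ≤ ‖symDexp w h‖ :=
  le_of_tendsto (tendsto_symDexp_pow_smul w h).norm
    (Filter.Eventually.of_forall fun n => hH.norm_symDexp_pow_smul_le hh n w hw)

theorem exists_symDexp_eq (hH : IsLieTripleSystem H) {w k : A} (hw : w ∈ H) (hk : k ∈ H) :
    ∃ h ∈ H, symDexp w h = k := by
  have : CompleteSpace H := hH.isClosed.completeSpace_coe
  -- The path `s ↦ s w` joins the identity at `s = 0` to the operator to be inverted at `s = 1`.
  let T : ℝ → H →L[ℝ] H := fun s =>
    (symDexp (s • w)).restrict (fun h hh => hH.symDexp_mem (H.smul_mem s hw) hh)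
  have hT : Continuous T := by
    rw [continuous_iff_continuousAt]
    intro t
    have hc : Continuous fun s : ℝ => symDexp (s • w) :=
      contDiff_symDexp.continuous.comp (continuous_id.smul continuous_const)
    refine (tendsto_iff_norm_sub_tendsto_zero (E := H →L[ℝ] H)).2 ?_
    refine squeeze_zero (fun _ => ContinuousLinearMap.opNorm_nonneg _) (fun s => ?_)
      ((tendsto_iff_norm_sub_tendsto_zero (E := A →L[ℝ] A)).1 (hc.tendsto t))
    refine ContinuousLinearMap.opNorm_le_bound _ (norm_nonneg _) fun v => ?_
    exact (symDexp (s • w) - symDexp (t • w)).le_opNorm (v : A)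
  have h0 : T 0 = 1 := by
    ext v
    simp [T, symDexp_zero]
  have hu := isUnit_of_continuous_of_norm_le hT h0
    (fun s v => hH.norm_le_norm_symDexp (H.smul_mem s hw) v.2) 1
  obtain ⟨u, hu⟩ := hu
  refine ⟨(u⁻¹ : (H →L[ℝ] H)ˣ).val ⟨k, hk⟩, Subtype.coe_prop _, ?_⟩
  have h2 : u.val ((u⁻¹ : (H →L[ℝ] H)ˣ).val ⟨k, hk⟩) = ⟨k, hk⟩ :=
    congrArg (fun S : H →L[ℝ] H => S ⟨k, hk⟩) u.mul_inv
  rw [hu] at h2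
  have h3 := congrArg Subtype.val h2
  simpa [T] using h3

end IsLieTripleSystem

end CStar

/-! ### The flow inside `H` and stability of `e^H` under `a ↦ e^x a e^x` -/

section

section Banach

variable {B : Type*} [NormedRing B] [NormedAlgebra ℝ B] [CompleteSpace B]

theorem contDiff_coshAd (h : B) : ContDiff ℝ 1 (fun w : B => coshAd w h) := by
  have h1 : ContDiff ℝ 1 (fun w : B => exp w) := contDiff_exp
  have h2 : ContDiff ℝ 1 (fun w : B => exp (-w)) := contDiff_exp.comp contDiff_neg
  exact (((h1.mul contDiff_const).mul h2).add ((h2.mul contDiff_const).mul h1)).const_smul _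

theorem exp_half_mul_coshAd_mul_exp_half (w x : B) :
    exp ((2⁻¹ : ℝ) • w) * ((2 : ℝ) • coshAd ((2⁻¹ : ℝ) • w) x) * exp ((2⁻¹ : ℝ) • w) =
      exp w * x + x * exp w := by
  rw [coshAd, smul_smul, mul_inv_cancel₀ two_ne_zero, one_smul, ← exp_half_mul_exp_half w]
  have a1 := exp_mul_exp_neg ((2⁻¹ : ℝ) • w)
  have a2 := exp_neg_mul_exp ((2⁻¹ : ℝ) • w)
  set p := exp ((2⁻¹ : ℝ) • w)
  set q := exp (-((2⁻¹ : ℝ) • w))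
  have a3 : ∀ z, p * (q * z) = z := fun z => by rw [← mul_assoc, a1, one_mul]
  simp only [mul_add, add_mul, mul_assoc, a2, a3, mul_one]

end Banach

variable {A : Type*} [CStarAlgebra A] [PartialOrder A] [StarOrderedRing A] {H : Submodule ℝ A}

namespace IsLieTripleSystem

/-- The logarithm of the curve is produced as an integral curve in the Banach space `H` of the field
`V` with `S_w (V w) = 2 cosh(ad w / 2) x`. -/
theorem exists_forall_exp_mul_exp_mul_exp_mem (hH : IsLieTripleSystem H) {x y : A} (hx : x ∈ H)
    (hy : y ∈ H) : ∃ ε > 0, ∀ s : ℝ, |s| < ε →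
      exp (s • x) * exp y * exp (s • x) ∈ exp '' (H : Set A) := by
  have : CompleteSpace H := hH.isClosed.completeSpace_coe
  set k : A → A := fun w => (2 : ℝ) • coshAd ((2⁻¹ : ℝ) • w) x with hk
  have hkd : ContDiff ℝ 1 k :=
    ((contDiff_coshAd x).comp (contDiff_id.const_smul (2⁻¹ : ℝ))).const_smul _
  have hkH : ∀ w ∈ H, k w ∈ H := fun w hw =>
    H.smul_mem _ (hH.coshAd_mem (H.smul_mem _ hw) hx)
  have hV' : ∀ w : H, ∃ v : H, symDexp (w : A) (v : A) = k w := fun w => by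
    obtain ⟨v, hv, e⟩ := hH.exists_symDexp_eq w.2 (hkH w w.2)
    exact ⟨⟨v, hv⟩, e⟩
  choose V hV using hV'
  obtain ⟨K₁, s₁, hs₁, hl₁⟩ := (contDiff_symDexp (B := A)).contDiffAt.exists_lipschitzOnWith (x := y)
  obtain ⟨K₂, s₂, hs₂, hl₂⟩ := hkd.contDiffAt.exists_lipschitzOnWith (x := y)
  have hbd : ∀ᶠ w in 𝓝 y, ‖k w‖ < ‖k y‖ + 1 :=
    hkd.continuous.norm.continuousAt.eventually (gt_mem_nhds (lt_add_one _))
  obtain ⟨a, ha, hball⟩ := Metric.nhds_basis_closedBall.mem_iff.1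
    (Filter.inter_mem (Filter.inter_mem hs₁ hs₂) hbd)
  let L : NNReal := ⟨‖k y‖ + 1, by positivity⟩
  let a' : NNReal := ⟨a, ha.le⟩
  set y' : H := ⟨y, hy⟩
  have hin : ∀ w ∈ Metric.closedBall y' a', (w : A) ∈ (s₁ ∩ s₂) ∩ {w | ‖k w‖ < ‖k y‖ + 1} :=
    fun w hw => hball hw
  have hVn : ∀ w : H, ‖V w‖ ≤ ‖k w‖ := fun w => by
    rw [← hV w]
    exact hH.norm_le_norm_symDexp w.2 (V w).2
  have hVb : ∀ w ∈ Metric.closedBall y' a', ‖V w‖ ≤ L := fun w hw =>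
    (hVn w).trans (hin w hw).2.le
  have hVl : LipschitzOnWith (K₂ + K₁ * L) V (Metric.closedBall y' a') := by
    refine LipschitzOnWith.of_dist_le_mul fun w hw w' hw' => ?_
    -- The operator inverse is never differentiated: since it has norm at most `1`, the Lipschitz
    -- bounds for `k` and `symDexp` suffice.
    have e : symDexp (w : A) ((V w - V w' : H) : A) =
        (k w - k w') - (symDexp (w : A) - symDexp (w' : A)) (V w') := by
      rw [Submodule.coe_sub, map_sub, hV w, sub_apply, hV w']
      abel
    have h1 := hH.norm_le_norm_symDexp w.2 (V w - V w').2
    rw [e] at h1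
    have h2 := hl₂.dist_le_mul _ (hin w hw).1.2 _ (hin w' hw').1.2
    have h3 := hl₁.dist_le_mul _ (hin w hw).1.1 _ (hin w' hw').1.1
    rw [dist_eq_norm] at h2 h3 ⊢
    have h4 := (symDexp (w : A) - symDexp (w' : A)).le_opNorm (V w' : A)
    have h5 : ‖(V w' : A)‖ ≤ L := hVb w' hw'
    refine h1.trans ((norm_sub_le _ _).trans ?_)
    calc ‖k w - k w'‖ + ‖(symDexp (w : A) - symDexp (w' : A)) (V w')‖
        ≤ K₂ * dist (w : A) w' + K₁ * dist (w : A) w' * L := by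
          refine add_le_add h2 (h4.trans ?_)
          gcongr
      _ = ((K₂ + K₁ * L : NNReal) : ℝ) * dist w w' := by
          rw [Subtype.dist_eq]; push_cast; ring
  have hLpos : 0 < (L : ℝ) := by change 0 < ‖k y‖ + 1; positivity
  -- A field bounded by `L` cannot leave the ball of radius `a` before time `a / L`.
  set ε := a / L with hε
  have hεpos : 0 < ε := div_pos ha hLpos
  have hPL : IsPicardLindelof (fun _ => V) (tmin := -ε) (tmax := ε)
      ⟨0, by constructor <;> linarith⟩ y' a' 0 L (K₂ + K₁ * L) := by
    refine IsPicardLindelof.of_time_independent hVb hVl ?_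
    simp only [sub_zero, zero_sub, neg_neg, max_self, NNReal.coe_zero]
    change (L : ℝ) * (a / L) ≤ a
    rw [mul_div_cancel₀ _ hLpos.ne']
  obtain ⟨α, hα0, hα⟩ := hPL.exists_eq_forall_mem_Icc_hasDerivWithinAt₀
  refine ⟨ε, hεpos, fun s hs => ⟨α s, (α s).2, ?_⟩⟩
  have hα' : ∀ t ∈ Ioo (-ε) ε, HasDerivAt (fun t => (α t : A)) (V (α t) : A) t := fun t ht =>
    H.subtypeL.hasFDerivAt.comp_hasDerivAt t
      ((hα t (Ioo_subset_Icc_self ht)).hasDerivAt (Icc_mem_nhds ht.1 ht.2))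
  -- Along the flow `(e^α)' = e^α x + x e^α`, which the two outer factors cancel.
  have hβ : ∀ t ∈ Ioo (-ε) ε,
      HasDerivAt (fun t : ℝ => exp (t • (-x)) * exp (α t : A) * exp (t • (-x))) 0 t := by
    intro t ht
    have h1 := hasDerivAt_exp_smul_const (𝕂 := ℝ) (-x) t
    have h1' := hasDerivAt_exp_smul_const' (𝕂 := ℝ) (-x) t
    have h2 : HasDerivAt (fun t => exp (α t : A)) (fderiv ℝ exp (α t : A) (V (α t) : A)) t :=
      (hasFDerivAt_exp' (α t : A)).comp_hasDerivAt t (hα' t ht)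
    rw [fderiv_exp_eq, hV, hk, exp_half_mul_coshAd_mul_exp_half] at h2
    refine ((h1.mul h2).mul h1').congr_deriv ?_
    simp only [Pi.mul_apply]
    noncomm_ring
  have hs' : s ∈ Ioo (-ε) ε := abs_lt.1 hs
  have hc := isOpen_Ioo.is_const_of_deriv_eq_zero (convex_Ioo (-ε) ε).isPreconnected
    (fun t ht => (hβ t ht).differentiableAt.differentiableWithinAt)
    (fun t ht => (hβ t ht).deriv) hs' (show (0 : ℝ) ∈ Ioo (-ε) ε by constructor <;> linarith)
  have hα0' : α 0 = y' := hα0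
  simp only [hα0', zero_smul, exp_zero, one_mul, mul_one, smul_neg, neg_zero] at hc
  have a1 := exp_mul_exp_neg (s • x)
  have a2 := exp_neg_mul_exp (s • x)
  calc exp (α s : A) = (exp (s • x) * exp (-(s • x))) * exp (α s : A) *
        (exp (-(s • x)) * exp (s • x)) := by rw [a1, a2, one_mul, mul_one]
    _ = exp (s • x) * (exp (-(s • x)) * exp (α s : A) * exp (-(s • x))) * exp (s • x) := by
        noncomm_ring
    _ = _ := by rw [hc]

end IsLieTripleSystem

theorem mem_exp_image_iff (hH : ∀ x ∈ H, IsSelfAdjoint x) {a : A} (ha : a ∈ posInv A) :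
    a ∈ exp '' (H : Set A) ↔ CFC.log a ∈ H := by
  constructor
  · rintro ⟨x, hx, rfl⟩
    rwa [CFC.log_exp x (hH x hx)]
  · intro h
    exact ⟨_, h, CFC.exp_log a (ha.1.isStrictlyPositive ha.2)⟩

theorem exp_mem_posInv {x : A} (hx : IsSelfAdjoint x) : exp x ∈ posInv A :=
  ⟨isUnit_exp' x, hx.exp_nonneg⟩

theorem exp_mul_mul_exp_mem_posInv {x a : A} (hx : IsSelfAdjoint x) (ha : a ∈ posInv A) :
    exp x * a * exp x ∈ posInv A := by
  refine ⟨((isUnit_exp' x).mul ha.1).mul (isUnit_exp' x), ?_⟩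
  have := star_left_conjugate_nonneg ha.2 (exp x)
  rwa [(isSelfAdjoint_exp hx).star_eq] at this

/-- The times `s` at which `e^(sx) e^y e^(sx)` lies in `e^H` form a clopen set containing `0`:
closed because `log` is continuous and `H` is closed, open because the local flow can be restarted
at any point `e^z` reached. -/
theorem IsLieTripleSystem.exp_mul_exp_mul_exp_mem (hH : IsLieTripleSystem H) {x y : A} (hx : x ∈ H)
    (hy : y ∈ H) : exp x * exp y * exp x ∈ exp '' (H : Set A) := by
  set f : ℝ → A := fun s => exp (s • x) * exp y * exp (s • x) with hf
  have hxs : ∀ s : ℝ, IsSelfAdjoint (s • x) := fun s => hH.isSelfAdjoint _ (H.smul_mem s hx)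
  have hfp : ∀ s, f s ∈ posInv A := fun s =>
    exp_mul_mul_exp_mem_posInv (hxs s) (exp_mem_posInv (hH.isSelfAdjoint y hy))
  have hfc : Continuous f := by
    have : Continuous fun s : ℝ => exp (s • x) :=
      continuous_exp.comp (continuous_id.smul continuous_const)
    exact (this.mul continuous_const).mul this
  have hlog : Continuous fun s => CFC.log (f s) :=
    CFC.continuousOn_log.comp_continuous hfc fun s => ⟨.of_nonneg (hfp s).2, (hfp s).1⟩
  have hset : {s | f s ∈ exp '' (H : Set A)} = {s | CFC.log (f s) ∈ H} := by
    ext s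
    exact mem_exp_image_iff hH.isSelfAdjoint (hfp s)
  have hclopen : IsClopen {s | f s ∈ exp '' (H : Set A)} := by
    constructor
    · rw [hset]
      exact hH.isClosed.preimage hlog
    · rw [Metric.isOpen_iff]
      rintro s ⟨z, hz, e⟩
      obtain ⟨ε, hε, h⟩ := hH.exists_forall_exp_mul_exp_mul_exp_mem hx hz
      refine ⟨ε, hε, fun t ht => ?_⟩
      have h1 := h (t - s) (by rwa [Metric.mem_ball, Real.dist_eq] at ht)
      have e1 : exp (t • x) = exp ((t - s) • x) * exp (s • x) := by
        rw [← exp_add_smul]; congr 2; ring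
      have e2 : exp (t • x) = exp (s • x) * exp ((t - s) • x) := by
        rw [← exp_add_smul]; congr 2; ring
      have e3 : f t = exp ((t - s) • x) * exp z * exp ((t - s) • x) := by
        rw [e]
        simp only [hf]
        nth_rewrite 1 [e1]
        rw [e2]
        noncomm_ring
      change f t ∈ exp '' (H : Set A)
      rwa [e3]
  have h1 : (1 : ℝ) ∈ {s | f s ∈ exp '' (H : Set A)} := by
    rw [hclopen.eq_univ ⟨0, y, hy, by simp [hf]⟩]
    trivial
  simpa [hf] using h1

end

/-! ### Explicit geodesics and geometric means -/

section

theorem eq_of_hasDerivWithinAt_zero {E : Type*} [NormedAddCommGroup E] [NormedSpace ℝ E]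
    {I : Set ℝ} (hI : Convex ℝ I) {f : ℝ → E} (hf : ∀ t ∈ I, HasDerivWithinAt f 0 I t) {s t : ℝ}
    (hs : s ∈ I) (ht : t ∈ I) : f s = f t := by
  have := hI.norm_image_sub_le_of_norm_hasDerivWithin_le (C := 0) hf (by simp) ht hs
  rw [zero_mul] at this
  exact sub_eq_zero.1 (norm_le_zero_iff.1 this)

theorem exp_conj_exp_half {B : Type*} [NormedRing B] [NormedAlgebra ℝ B] [CompleteSpace B]
    (x v : B) : exp x * exp (exp (-x) * v * exp x) = exp v * exp x := by
  let := NormedAlgebra.restrictScalars ℚ ℝ B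
  have h : SemiconjBy (exp x) (exp (-x) * v * exp x) v := by
    rw [SemiconjBy, ← mul_assoc, ← mul_assoc, exp_mul_exp_neg, one_mul]
  exact h.exp_right

variable {A : Type*} [CStarAlgebra A]

/-- The curve `t ↦ exp (x/2) * exp (t v) * exp (x/2)`: the geodesic through `exp x` with symmetrized
initial velocity `v`. -/
noncomputable def geodesic (x v : A) (t : ℝ) : A :=
  exp ((2⁻¹ : ℝ) • x) * exp (t • v) * exp ((2⁻¹ : ℝ) • x)

theorem geodesic_zero (x v : A) : geodesic x v 0 = exp x := by
  simp [geodesic, exp_half_mul_exp_half]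

theorem exp_half_mul_mul_exp_half_eq_iff (x a b : A) :
    exp ((2⁻¹ : ℝ) • x) * a * exp ((2⁻¹ : ℝ) • x) = b ↔
      a = exp ((2⁻¹ : ℝ) • (-x)) * b * exp ((2⁻¹ : ℝ) • (-x)) := by
  have a1 := exp_mul_exp_neg ((2⁻¹ : ℝ) • x)
  have a2 := exp_neg_mul_exp ((2⁻¹ : ℝ) • x)
  rw [smul_neg]
  set p := exp ((2⁻¹ : ℝ) • x)
  set q := exp (-((2⁻¹ : ℝ) • x))
  constructor
  · rintro rfl
    calc a = (q * p) * a * (p * q) := by rw [a1, a2, one_mul, mul_one]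
      _ = _ := by noncomm_ring
  · rintro rfl
    calc p * (q * b * q) * p = (p * q) * b * (q * p) := by noncomm_ring
      _ = _ := by rw [a1, a2, one_mul, mul_one]

variable [PartialOrder A] [StarOrderedRing A]

/-- The equation `γ'' = γ' γ⁻¹ γ'` says that `c = γ⁻¹ γ'` is conserved, so `γ t = e^x e^(tc)`.
Conjugating `c` by `e^(x/2)` gives the symmetric form. -/
theorem IsGeodesicOn.exists_eq_geodesic {I : Set ℝ} (hI : Convex ℝ I) (hu : UniqueDiffOn ℝ I)
    (h0 : (0 : ℝ) ∈ I) {γ : ℝ → A} (hγ : IsGeodesicOn I γ) {x : A} (hx : IsSelfAdjoint x)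
    (hγ0 : γ 0 = exp x) : ∃ v, IsSelfAdjoint v ∧ ∀ t ∈ I, γ t = geodesic x v t := by
  set δ := derivWithin γ I with hδ
  have hd : ∀ t ∈ I, HasDerivWithinAt γ (δ t) I t := fun t ht =>
    (hγ.contDiffOn.differentiableOn (by norm_num) t ht).hasDerivWithinAt
  have hδd : ∀ t ∈ I, HasDerivWithinAt δ (δ t * Ring.inverse (γ t) * δ t) I t := by
    intro t ht
    have h1 := ((hγ.contDiffOn.derivWithin hu (m := 1) (by norm_num)).differentiableOn
      (by norm_num) t ht).hasDerivWithinAt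
    have h2 := hγ.euler t ht
    rw [covariantDeriv, ← two_smul ℝ, smul_smul, inv_mul_cancel₀ two_ne_zero, one_smul,
      sub_eq_zero] at h2
    rwa [h2] at h1
  have hinv : ∀ t ∈ I, γ t * Ring.inverse (γ t) = 1 ∧ Ring.inverse (γ t) * γ t = 1 := fun t ht =>
    ⟨Ring.mul_inverse_cancel _ (hγ.mapsTo ht).1, Ring.inverse_mul_cancel _ (hγ.mapsTo ht).1⟩
  have hinvd : ∀ t ∈ I, HasDerivWithinAt (fun t => Ring.inverse (γ t))
      (-(Ring.inverse (γ t) * δ t * Ring.inverse (γ t))) I t := by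
    intro t ht
    obtain ⟨u, hu⟩ := (hγ.mapsTo ht).1
    have h1 := hasFDerivAt_ringInverse (𝕜 := ℝ) u
    rw [hu] at h1
    have h2 := h1.comp_hasDerivWithinAt t (hd t ht)
    refine h2.congr_deriv ?_
    rw [← hu, Ring.inverse_unit]
    simp
  have hc : ∀ t ∈ I, HasDerivWithinAt (fun t => Ring.inverse (γ t) * δ t) 0 I t := by
    intro t ht
    refine ((hinvd t ht).mul (hδd t ht)).congr_deriv ?_
    noncomm_ring
  set c := Ring.inverse (γ 0) * δ 0 with hcdef
  have hδc : ∀ t ∈ I, δ t = γ t * c := by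
    intro t ht
    rw [hcdef, eq_of_hasDerivWithinAt_zero hI hc h0 ht, ← mul_assoc, (hinv t ht).1, one_mul]
  have hη : ∀ t ∈ I, HasDerivWithinAt (fun t : ℝ => γ t * exp (t • (-c))) 0 I t := by
    intro t ht
    refine ((hd t ht).mul (hasDerivAt_exp_smul_const' (𝕂 := ℝ) (-c) t).hasDerivWithinAt).congr_deriv
      ?_
    rw [hδc t ht]
    noncomm_ring
  have hγt : ∀ t ∈ I, γ t = exp x * exp (t • c) := by
    intro t ht
    have h1 := eq_of_hasDerivWithinAt_zero hI hη ht h0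
    simp only [zero_smul, exp_zero, mul_one, hγ0, smul_neg, neg_zero] at h1
    rw [← h1, mul_assoc, exp_neg_mul_exp, mul_one]
  have hδs : IsSelfAdjoint (δ 0) := by
    have h1 := (hd 0 h0).star
    have h2 : HasDerivWithinAt γ (star (δ 0)) I 0 := by
      refine h1.congr (fun t ht => ?_) ?_
      · exact (IsSelfAdjoint.of_nonneg (hγ.mapsTo ht).2).star_eq.symm
      · exact (IsSelfAdjoint.of_nonneg (hγ.mapsTo h0).2).star_eq.symm
    exact (hu 0 h0).eq_deriv _ h2 (hd 0 h0)
  set p := exp ((2⁻¹ : ℝ) • x) with hp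
  set q := exp (-((2⁻¹ : ℝ) • x)) with hq
  have hpq : p * q = 1 := exp_mul_exp_neg _
  have hqp : q * p = 1 := exp_neg_mul_exp _
  have hpp : p * p = exp x := exp_half_mul_exp_half x
  -- `c` itself need not be selfadjoint; this form shows that its conjugate is.
  have hv : p * c * q = q * δ 0 * q := by
    rw [hδc 0 h0, hγ0, ← hpp]
    calc p * c * q = (1 : A) * p * c * q := by rw [one_mul]
      _ = _ := by rw [← hqp]; noncomm_ring
  refine ⟨p * c * q, ?_, fun t ht => ?_⟩
  · rw [hv]
    have hqs : star q = q :=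
      (isSelfAdjoint_exp (((IsSelfAdjoint.all (2⁻¹ : ℝ)).smul hx).neg)).star_eq
    have := hδs.conjugate q
    rwa [hqs] at this
  · have h1 := exp_conj_exp_half ((2⁻¹ : ℝ) • x) (t • (p * c * q))
    have h2 : q * (t • (p * c * q)) * p = t • c := by
      rw [mul_smul_comm, smul_mul_assoc]
      congr 1
      calc q * (p * c * q) * p = (q * p) * c * (q * p) := by noncomm_ring
        _ = c := by rw [hqp, one_mul, mul_one]
    rw [← hp, ← hq, h2] at h1
    rw [hγt t ht, geodesic, ← hp, mul_assoc, ← h1, ← mul_assoc, hpp]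

theorem isGeodesicOn_geodesic {I : Set ℝ} (hu : UniqueDiffOn ℝ I) {x v : A} (hx : IsSelfAdjoint x)
    (hv : IsSelfAdjoint v) : IsGeodesicOn I (geodesic x v) := by
  have hx2 : IsSelfAdjoint ((2⁻¹ : ℝ) • x) := (IsSelfAdjoint.all (2⁻¹ : ℝ)).smul hx
  set p := exp ((2⁻¹ : ℝ) • x) with hp
  set q := exp (-((2⁻¹ : ℝ) • x)) with hq
  have hpq : p * q = 1 := exp_mul_exp_neg _
  have hqp : q * p = 1 := exp_neg_mul_exp _
  have hd : ∀ t, HasDerivAt (geodesic x v) (p * (v * exp (t • v)) * p) t := fun t =>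
    ((hasDerivAt_exp_smul_const' (𝕂 := ℝ) v t).const_mul p).mul_const p
  have hdw : ∀ t ∈ I, derivWithin (geodesic x v) I t = p * (v * exp (t • v)) * p := fun t ht =>
    (hd t).hasDerivWithinAt.derivWithin (hu t ht)
  have hd2 : ∀ t, HasDerivAt (fun t : ℝ => p * (v * exp (t • v)) * p)
      (p * (v * (v * exp (t • v))) * p) t := fun t =>
    (((hasDerivAt_exp_smul_const' (𝕂 := ℝ) v t).const_mul v).const_mul p).mul_const p
  have hdw2 : ∀ t ∈ I, derivWithin (derivWithin (geodesic x v) I) I t =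
      p * (v * (v * exp (t • v))) * p := fun t ht => by
    rw [derivWithin_congr hdw (hdw t ht)]
    exact (hd2 t).hasDerivWithinAt.derivWithin (hu t ht)
  refine ⟨fun t _ => ?_, ?_, fun t ht => ?_⟩
  · exact exp_mul_mul_exp_mem_posInv hx2 (exp_mem_posInv ((IsSelfAdjoint.all t).smul hv))
  · have : ContDiff ℝ 2 (fun t : ℝ => exp (t • v)) :=
      contDiff_exp.comp (contDiff_id.smul contDiff_const)
    exact ((contDiff_const.mul this).mul contDiff_const).contDiffOn
  · set e := exp (t • v) with he
    set f := exp (-(t • v)) with hf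
    have hef : e * f = 1 := exp_mul_exp_neg _
    have hfe : f * e = 1 := exp_neg_mul_exp _
    have hinv : Ring.inverse (geodesic x v t) = q * f * q := by
      refine Ring.inverse_unit ⟨p * e * p, q * f * q, ?_, ?_⟩
      · calc p * e * p * (q * f * q) = p * e * (p * q) * f * q := by noncomm_ring
          _ = p * (e * f) * q := by rw [hpq, mul_one, mul_assoc p]
          _ = 1 := by rw [hef, mul_one, hpq]
      · calc q * f * q * (p * e * p) = q * f * (q * p) * e * p := by noncomm_ring
          _ = q * (f * e) * p := by rw [hqp, mul_one, mul_assoc q]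
          _ = 1 := by rw [hfe, mul_one, hqp]
    rw [covariantDeriv, hdw2 t ht, hdw t ht, hinv, ← two_smul ℝ, smul_smul,
      inv_mul_cancel₀ two_ne_zero, one_smul, sub_eq_zero]
    have b1 : ∀ z, p * (q * z) = z := fun z => by rw [← mul_assoc, hpq, one_mul]
    have b2 : ∀ z, q * (p * z) = z := fun z => by rw [← mul_assoc, hqp, one_mul]
    have b3 : ∀ z, e * (f * z) = z := fun z => by rw [← mul_assoc, hef, one_mul]
    simp only [mul_assoc, ← he, b1, b2, b3]

theorem IsLieTripleSystem.geodesic_mem {H : Submodule ℝ A} (hH : IsLieTripleSystem H) {I : Set ℝ}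
    (hI : Convex ℝ I) (hu : UniqueDiffOn ℝ I) (h0 : (0 : ℝ) ∈ I) (h1 : (1 : ℝ) ∈ I) {γ : ℝ → A}
    (hγ : IsGeodesicOn I γ) (hγ0 : γ 0 ∈ exp '' (H : Set A)) (hγ1 : γ 1 ∈ exp '' (H : Set A))
    {t : ℝ} (ht : t ∈ I) : γ t ∈ exp '' (H : Set A) := by
  obtain ⟨x, hx, hx0⟩ := hγ0
  obtain ⟨y, hy, hy1⟩ := hγ1
  obtain ⟨v, hv, hvt⟩ := hγ.exists_eq_geodesic hI hu h0 (hH.isSelfAdjoint x hx) hx0.symm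
  have hv1 := hvt 1 h1
  rw [← hy1, geodesic, one_smul, eq_comm, exp_half_mul_mul_exp_half_eq_iff] at hv1
  obtain ⟨z, hz, hzv⟩ := hH.exp_mul_exp_mul_exp_mem (H.smul_mem (2⁻¹ : ℝ) (H.neg_mem hx)) hy
  have hvz : v = z := by
    rw [← CFC.log_exp v hv, hv1, ← hzv, CFC.log_exp z (hH.isSelfAdjoint z hz)]
  rw [hvt t ht, geodesic, hvz]
  exact hH.exp_mul_exp_mul_exp_mem (H.smul_mem _ hx) (H.smul_mem _ hz)

/-- The geometric mean `exp x # exp y`, the midpoint of the geodesic from `exp x` to `exp y`. -/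
noncomputable def geometricMeanExp (x y : A) : A :=
  geodesic x (CFC.log (exp ((2⁻¹ : ℝ) • (-x)) * exp y * exp ((2⁻¹ : ℝ) • (-x)))) 2⁻¹

theorem exp_half_neg_conj_mem_posInv {x y : A} (hx : IsSelfAdjoint x) (hy : IsSelfAdjoint y) :
    exp ((2⁻¹ : ℝ) • (-x)) * exp y * exp ((2⁻¹ : ℝ) • (-x)) ∈ posInv A :=
  exp_mul_mul_exp_mem_posInv ((IsSelfAdjoint.all (2⁻¹ : ℝ)).smul hx.neg) (exp_mem_posInv hy)

theorem geodesic_log_one {x y : A} (hx : IsSelfAdjoint x) (hy : IsSelfAdjoint y) :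
    geodesic x (CFC.log (exp ((2⁻¹ : ℝ) • (-x)) * exp y * exp ((2⁻¹ : ℝ) • (-x)))) 1 = exp y := by
  have h := exp_half_neg_conj_mem_posInv hx hy
  rw [geodesic, one_smul, exp_half_mul_mul_exp_half_eq_iff,
    CFC.exp_log _ (h.1.isStrictlyPositive h.2)]

theorem geometricMeanExp_mem_posInv {x : A} (hx : IsSelfAdjoint x) (y : A) :
    geometricMeanExp x y ∈ posInv A :=
  exp_mul_mul_exp_mem_posInv ((IsSelfAdjoint.all (2⁻¹ : ℝ)).smul hx)
    (exp_mem_posInv ((IsSelfAdjoint.all (2⁻¹ : ℝ)).smul .log))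

/-- The Riccati equation of the midpoint involves only exponentials, so the logarithm of the mean
can be expanded without expanding `log`. -/
theorem geometricMeanExp_mul_exp_neg_mul {x y : A} (hx : IsSelfAdjoint x) (hy : IsSelfAdjoint y) :
    geometricMeanExp x y * exp (-x) * geometricMeanExp x y = exp y := by
  rw [← geodesic_log_one hx hy, geometricMeanExp]
  set v := CFC.log (exp ((2⁻¹ : ℝ) • (-x)) * exp y * exp ((2⁻¹ : ℝ) • (-x)))
  have a1 := exp_mul_exp_neg ((2⁻¹ : ℝ) • x)
  have a2 := exp_neg_mul_exp ((2⁻¹ : ℝ) • x)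
  rw [geodesic, geodesic, one_smul, ← exp_half_mul_exp_half v, ← exp_half_mul_exp_half (-x), smul_neg]
  set p := exp ((2⁻¹ : ℝ) • x)
  set q := exp (-((2⁻¹ : ℝ) • x))
  set e := exp ((2⁻¹ : ℝ) • v)
  calc p * e * p * (q * q) * (p * e * p) = p * e * (p * q) * (q * p) * e * p := by noncomm_ring
    _ = p * (e * e) * p := by rw [a1, a2, mul_one, mul_one]; noncomm_ring

theorem continuous_log_geometricMeanExp {x y : ℝ → A} (hx : ∀ s, IsSelfAdjoint (x s))
    (hy : ∀ s, IsSelfAdjoint (y s)) (hxc : Continuous x) (hyc : Continuous y) :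
    Continuous fun s => CFC.log (geometricMeanExp (x s) (y s)) := by
  refine CFC.continuousOn_log.comp_continuous ?_ fun s =>
    ⟨.of_nonneg (geometricMeanExp_mem_posInv (hx s) (y s)).2,
      (geometricMeanExp_mem_posInv (hx s) (y s)).1⟩
  have h1 : Continuous fun s => exp ((2⁻¹ : ℝ) • x s) := continuous_exp.comp (hxc.const_smul _)
  have h2 : Continuous fun s => exp ((2⁻¹ : ℝ) • (-x s)) :=
    continuous_exp.comp (hxc.neg.const_smul _)
  have h3 := CFC.continuousOn_log.comp_continuous ((h2.mul (continuous_exp.comp hyc)).mul h2)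
    fun s => ⟨.of_nonneg (exp_half_neg_conj_mem_posInv (hx s) (hy s)).2,
      (exp_half_neg_conj_mem_posInv (hx s) (hy s)).1⟩
  exact (h1.mul (continuous_exp.comp (h3.const_smul (2⁻¹ : ℝ)))).mul h1

end

/-! ### Third-order expansions at `0` -/

open Asymptotics Filter

section Jets

variable {B : Type*} [NormedRing B] [NormedAlgebra ℝ B]

/-- `f s = a₀ + s a₁ + s² a₂ + s³ a₃ + O(s⁴)` as `s → 0`. -/
def HasCubicExpansion (f : ℝ → B) (a₀ a₁ a₂ a₃ : B) : Prop :=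
  (fun s : ℝ => f s - (a₀ + s • a₁ + s ^ 2 • a₂ + s ^ 3 • a₃)) =O[𝓝 0] fun s : ℝ => s ^ 4

namespace HasCubicExpansion

variable {f g : ℝ → B} {a₀ a₁ a₂ a₃ b₀ b₁ b₂ b₃ : B}

theorem congr_coeff (hf : HasCubicExpansion f a₀ a₁ a₂ a₃) (h₀ : a₀ = b₀) (h₁ : a₁ = b₁)
    (h₂ : a₂ = b₂) (h₃ : a₃ = b₃) : HasCubicExpansion f b₀ b₁ b₂ b₃ := by
  subst h₀ h₁ h₂ h₃; exact hf

theorem polynomial (a₀ a₁ a₂ a₃ : B) :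
    HasCubicExpansion (fun s : ℝ => a₀ + s • a₁ + s ^ 2 • a₂ + s ^ 3 • a₃) a₀ a₁ a₂ a₃ := by
  simp only [HasCubicExpansion, sub_self]
  exact isBigO_zero _ _

theorem add (hf : HasCubicExpansion f a₀ a₁ a₂ a₃) (hg : HasCubicExpansion g b₀ b₁ b₂ b₃) :
    HasCubicExpansion (fun s => f s + g s) (a₀ + b₀) (a₁ + b₁) (a₂ + b₂) (a₃ + b₃) := by
  refine (IsBigO.add hf hg).congr_left fun s => ?_
  simp only [smul_add]
  abel

theorem const_smul (r : ℝ) (hf : HasCubicExpansion f a₀ a₁ a₂ a₃) :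
    HasCubicExpansion (fun s => r • f s) (r • a₀) (r • a₁) (r • a₂) (r • a₃) := by
  refine (IsBigO.const_smul_left hf r).congr_left fun s => ?_
  simp only [Pi.smul_apply, smul_sub, smul_add, smul_comm r]

theorem sub (hf : HasCubicExpansion f a₀ a₁ a₂ a₃) (hg : HasCubicExpansion g b₀ b₁ b₂ b₃) :
    HasCubicExpansion (fun s => f s - g s) (a₀ - b₀) (a₁ - b₁) (a₂ - b₂) (a₃ - b₃) := by
  refine (IsBigO.sub hf hg).congr_left fun s => ?_
  simp only [smul_sub]
  abel

theorem isBigO_pow_four (hf : HasCubicExpansion f 0 0 0 0) : f =O[𝓝 0] fun s : ℝ => s ^ 4 := by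
  refine IsBigO.congr_left hf fun s => by simp

theorem continuous_polynomial (a₀ a₁ a₂ a₃ : B) :
    Continuous fun s : ℝ => a₀ + s • a₁ + s ^ 2 • a₂ + s ^ 3 • a₃ := by fun_prop

theorem isBigO_one (hf : HasCubicExpansion f a₀ a₁ a₂ a₃) : f =O[𝓝 0] fun _ => (1 : ℝ) := by
  have h1 := ((continuous_polynomial a₀ a₁ a₂ a₃).tendsto 0).isBigO_one ℝ
  have h2 : (fun s : ℝ => s ^ 4) =O[𝓝 0] fun _ => (1 : ℝ) :=
    ((continuous_pow 4).tendsto (0 : ℝ)).isBigO_one ℝ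
  exact ((IsBigO.trans hf h2).add h1).congr_left fun s => by abel

theorem mul (hf : HasCubicExpansion f a₀ a₁ a₂ a₃) (hg : HasCubicExpansion g b₀ b₁ b₂ b₃) :
    HasCubicExpansion (fun s => f s * g s) (a₀ * b₀) (a₀ * b₁ + a₁ * b₀)
      (a₀ * b₂ + a₁ * b₁ + a₂ * b₀) (a₀ * b₃ + a₁ * b₂ + a₂ * b₁ + a₃ * b₀) := by
  set P : ℝ → B := fun s => a₀ + s • a₁ + s ^ 2 • a₂ + s ^ 3 • a₃ with hP
  set R : ℝ → B := fun s => (a₁ * b₃ + a₂ * b₂ + a₃ * b₁) + s • (a₂ * b₃ + a₃ * b₂) +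
    s ^ 2 • (a₃ * b₃) + s ^ 3 • (0 : B) with hR
  have hPb := ((continuous_polynomial a₀ a₁ a₂ a₃).tendsto 0).isBigO_one ℝ
  have hRb := ((continuous_polynomial (a₁ * b₃ + a₂ * b₂ + a₃ * b₁) (a₂ * b₃ + a₃ * b₂)
    (a₃ * b₃) 0).tendsto 0).isBigO_one ℝ
  have h1 := IsBigO.mul hf hg.isBigO_one
  have h2 := IsBigO.mul hPb hg
  have h3 := (isBigO_refl (fun s : ℝ => s ^ 4) (𝓝 0)).smul hRb
  simp only [mul_one, one_mul, smul_eq_mul] at h1 h2 h3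
  refine ((h1.add h2).add h3).congr_left fun s => ?_
  simp only [sub_mul, mul_sub, add_mul, mul_add, smul_mul_assoc, mul_smul_comm, smul_add, smul_smul,
    smul_zero]
  module

/-- A zero constant term gives `f = O(s)`, so the exponential series beyond degree three contributes
`O(s⁴)`. -/
theorem exp [CompleteSpace B] (hf : HasCubicExpansion f 0 a₁ a₂ a₃) :
    HasCubicExpansion (fun s => exp (f s)) 1 a₁ (a₂ + (2⁻¹ : ℝ) • (a₁ * a₁))
      (a₃ + (2⁻¹ : ℝ) • (a₁ * a₂ + a₂ * a₁) + (6⁻¹ : ℝ) • (a₁ * a₁ * a₁)) := by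
  have hfs : f =O[𝓝 0] fun s : ℝ => s := by
    have h1 : (fun s : ℝ => s ^ 4) =O[𝓝 0] fun s : ℝ => s :=
      (isLittleO_pow_id (by norm_num)).isBigO
    have h2 := (isBigO_refl (fun s : ℝ => s) (𝓝 0)).smul
      (((continuous_polynomial a₁ a₂ a₃ 0).tendsto 0).isBigO_one ℝ)
    simp only [smul_eq_mul, mul_one] at h2
    refine ((IsBigO.trans hf h1).add h2).congr_left fun s => ?_
    module
  have hf0 : Tendsto f (𝓝 0) (𝓝 0) := hfs.trans_tendsto tendsto_id
  have h1 := (exp_hasFPowerSeriesAt_zero (𝕂 := ℝ) (𝔸 := B)).isBigO_sub_partialSum_pow 4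
  have h2 := (h1.comp_tendsto hf0).trans ((hfs.norm_left.pow 4))
  have hff := hf.mul hf
  have hT := (((polynomial (1 : B) 0 0 0).add hf).add (hff.const_smul (2⁻¹ : ℝ))).add
    ((hff.mul hf).const_smul (6⁻¹ : ℝ))
  refine HasCubicExpansion.congr_coeff (a₀ := 1) (IsBigO.congr_left (IsBigO.add h2 hT) fun s => ?_)
    rfl rfl rfl rfl
  simp [FormalMultilinearSeries.partialSum, Finset.sum_range_succ, expSeries_apply_eq, pow_succ,
    Nat.factorial]

end HasCubicExpansion

/-- The cubic coefficient of `log (exp (s x) # exp (s y))`. -/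
theorem hasCubicExpansion_riccati [CompleteSpace B] (x y : B) :
    HasCubicExpansion (fun s : ℝ =>
      exp (0 + s • ((2⁻¹ : ℝ) • (x + y)) + s ^ 2 • (0 : B) +
        s ^ 3 • ((48⁻¹ : ℝ) • (⁅y, ⁅x, y⁆⁆ - ⁅x, ⁅x, y⁆⁆))) * exp (s • (-x)) *
      exp (0 + s • ((2⁻¹ : ℝ) • (x + y)) + s ^ 2 • (0 : B) +
        s ^ 3 • ((48⁻¹ : ℝ) • (⁅y, ⁅x, y⁆⁆ - ⁅x, ⁅x, y⁆⁆))) - exp (s • y)) 0 0 0 0 := by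
  have hl : ∀ z : B, HasCubicExpansion (fun s : ℝ => s • z) 0 z 0 0 := fun z => by
    simpa using HasCubicExpansion.polynomial (0 : B) z 0 0
  have hw := (HasCubicExpansion.polynomial (0 : B) ((2⁻¹ : ℝ) • (x + y)) 0
    ((48⁻¹ : ℝ) • (⁅y, ⁅x, y⁆⁆ - ⁅x, ⁅x, y⁆⁆))).exp
  refine (((hw.mul (hl (-x)).exp).mul hw).sub (hl y).exp).congr_coeff ?_ ?_ ?_ ?_
  · simp
  · simp only [mul_one, one_mul]
    module
  · simp only [mul_one, one_mul, mul_add, add_mul, smul_mul_assoc, mul_smul_comm, smul_add,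
      mul_neg, neg_mul, zero_add]
    module
  · simp only [Ring.lie_def, mul_one, one_mul, mul_add, add_mul, mul_sub, sub_mul, smul_sub,
      smul_mul_assoc, mul_smul_comm, smul_add, mul_neg, neg_mul, zero_add, mul_zero, zero_mul,
      mul_assoc, smul_neg, neg_neg, smul_zero]
    module

/-- The cubic polynomial `w₀` solves the equation up to `O(s⁴)`, hence `w - w₀ = O(s⁴)`, and `c` is
the limit of `s⁻³ (w s - s m)`, a quotient of elements of `H` by scalars. Only `w → 0` is needed,
not smoothness of `w`. -/
theorem lie_sub_lie_mem_of_riccati [CompleteSpace B] (H : Submodule ℝ B)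
    (hclosed : IsClosed (H : Set B)) {x y : B} (hx : x ∈ H) (hy : y ∈ H) {w : ℝ → B}
    (hw : Tendsto w (𝓝 0) (𝓝 0)) (hwH : ∀ s, w s ∈ H)
    (hr : ∀ s : ℝ, exp (w s) * exp (s • (-x)) * exp (w s) = exp (s • y)) :
    ⁅y, ⁅x, y⁆⁆ - ⁅x, ⁅x, y⁆⁆ ∈ H := by
  set c := (48⁻¹ : ℝ) • (⁅y, ⁅x, y⁆⁆ - ⁅x, ⁅x, y⁆⁆) with hc
  set m := (2⁻¹ : ℝ) • (x + y) with hm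
  set w₀ : ℝ → B := fun s => 0 + s • m + s ^ 2 • (0 : B) + s ^ 3 • c with hw₀
  have hw₀t : Tendsto w₀ (𝓝 0) (𝓝 0) := by
    simpa [hw₀] using
      (HasCubicExpansion.continuous_polynomial (0 : B) m 0 c).tendsto 0
  have hb : Tendsto (fun s : ℝ => exp (s • (-x))) (𝓝 0) (𝓝 1) := by
    have : Continuous fun s : ℝ => exp (s • (-x)) :=
      continuous_exp.comp (continuous_id.smul continuous_const)
    simpa using this.tendsto 0
  have he : HasStrictFDerivAt (fun p : B × B => exp p.1) (ContinuousLinearMap.fst ℝ B B)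
      ((0 : B), (1 : B)) := by
    have h0 : HasStrictFDerivAt (exp : B → B) (1 : B →L[ℝ] B) ((0 : B), (1 : B)).1 :=
      hasStrictFDerivAt_exp_zero
    exact h0.comp ((0 : B), (1 : B)) (f := Prod.fst) hasStrictFDerivAt_fst
  -- Strict derivative of `(w, b) ↦ e^w b e^w` at `(0, 1)`. The two points compared below share `b`,
  -- so the linear term is exactly `2 (w - w₀)`.
  have hΦ := (he.mul' hasStrictFDerivAt_snd).mul' he
  have ht : Tendsto (fun s : ℝ => ((w s, exp (s • (-x))), (w₀ s, exp (s • (-x))))) (𝓝 0)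
      (𝓝 (((0 : B), (1 : B)), ((0 : B), (1 : B)))) :=
    (hw.prodMk_nhds hb).prodMk_nhds (hw₀t.prodMk_nhds hb)
  have hlo := hΦ.isLittleO.comp_tendsto ht
  have hlo' : (fun s : ℝ => (exp (s • y) - exp (w₀ s) * exp (s • (-x)) * exp (w₀ s)) -
      (2 : ℝ) • (w s - w₀ s)) =o[𝓝 0] fun s => (2 : ℝ) • (w s - w₀ s) := by
    refine (hlo.congr_left fun s => ?_).trans_isBigO ?_
    · rw [← hr]
      simp [two_smul]
    · refine IsBigO.of_bound 1 (Eventually.of_forall fun s => ?_)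
      simp only [Function.comp, Prod.mk_sub_mk, sub_self, Prod.norm_mk, norm_zero, norm_smul]
      rw [max_eq_left (norm_nonneg _)]
      norm_num
      linarith [norm_nonneg (w s - w₀ s)]
  have hO : (fun s => (2 : ℝ) • (w s - w₀ s)) =O[𝓝 0] fun s : ℝ => s ^ 4 := by
    refine hlo'.right_isBigO_add.trans ?_
    refine (hasCubicExpansion_riccati x y).isBigO_pow_four.neg_left.congr_left fun s => ?_
    simp only [hw₀, hm, hc]
    abel
  have hO' : (fun s => w s - w₀ s) =O[𝓝 0] fun s : ℝ => s ^ 4 := by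
    refine (hO.const_smul_left (2⁻¹ : ℝ)).congr_left fun s => ?_
    simp [smul_smul]
  have hlim : Tendsto (fun s : ℝ => (s ^ 3)⁻¹ • (w s - s • m)) (𝓝[≠] 0) (𝓝 c) := by
    have h1 : (fun s : ℝ => (s ^ 3)⁻¹ • (w s - w₀ s)) =O[𝓝[≠] 0] fun s : ℝ => s := by
      refine ((isBigO_refl (fun s : ℝ => (s ^ 3)⁻¹) (𝓝[≠] 0)).smul
        (hO'.mono nhdsWithin_le_nhds)).congr' EventuallyEq.rfl ?_
      filter_upwards [self_mem_nhdsWithin] with s hs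
      have : s ≠ 0 := hs
      simp only [smul_eq_mul]
      field_simp
    have h2 := (h1.trans_tendsto (tendsto_id.mono_left nhdsWithin_le_nhds)).add_const c
    rw [zero_add] at h2
    refine h2.congr' ?_
    filter_upwards [self_mem_nhdsWithin] with s hs
    have hs3 : s ^ 3 ≠ 0 := pow_ne_zero 3 hs
    have e : w s - s • m = (w s - w₀ s) + s ^ 3 • c := by
      simp only [hw₀, smul_zero, zero_add, add_zero]
      abel
    rw [e, smul_add, smul_smul (s ^ 3)⁻¹, inv_mul_cancel₀ hs3, one_smul]
  have hcH : c ∈ H := hclosed.mem_of_tendsto hlim (Eventually.of_forall fun s =>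
    H.smul_mem _ (H.sub_mem (hwH s) (H.smul_mem _ (H.smul_mem _ (H.add_mem hx hy)))))
  have := H.smul_mem (48 : ℝ) hcH
  rwa [hc, smul_smul, mul_inv_cancel₀ (by norm_num), one_smul] at this

end Jets

/-! ### From midpoints to the triple bracket -/

section CStar

variable {A : Type*} [CStarAlgebra A] [PartialOrder A] [StarOrderedRing A] {H : Submodule ℝ A}

theorem isLieTripleSystem_of_geometricMeanExp_mem (hH : ∀ x ∈ H, IsSelfAdjoint x)
    (hclosed : IsClosed (H : Set A))
    (hmean : ∀ x ∈ H, ∀ y ∈ H, geometricMeanExp x y ∈ exp '' (H : Set A)) :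
    IsLieTripleSystem H := by
  have key : ∀ x ∈ H, ∀ y ∈ H, ⁅y, ⁅x, y⁆⁆ - ⁅x, ⁅x, y⁆⁆ ∈ H := by
    intro x hx y hy
    have hxs : ∀ s : ℝ, IsSelfAdjoint (s • x) := fun s => hH _ (H.smul_mem s hx)
    have hys : ∀ s : ℝ, IsSelfAdjoint (s • y) := fun s => hH _ (H.smul_mem s hy)
    have hpos : ∀ s : ℝ, geometricMeanExp (s • x) (s • y) ∈ posInv A := fun s =>
      geometricMeanExp_mem_posInv (hxs s) _
    have hcont := continuous_log_geometricMeanExp hxs hys (continuous_id.smul continuous_const)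
      (continuous_id.smul continuous_const)
    refine lie_sub_lie_mem_of_riccati H hclosed hx hy
      (w := fun s => CFC.log (geometricMeanExp (s • x) (s • y))) ?_ (fun s => ?_) fun s => ?_
    · have := hcont.tendsto 0
      simpa [geometricMeanExp, geodesic] using this
    · exact (mem_exp_image_iff hH (hpos s)).1
        (hmean _ (H.smul_mem s hx) _ (H.smul_mem s hy))
    · rw [CFC.exp_log _ ((hpos s).1.isStrictlyPositive (hpos s).2), smul_neg]
      exact geometricMeanExp_mul_exp_neg_mul (hxs s) (hys s)
  refine ⟨hH, hclosed, fun x hx y hy => ?_⟩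
  have h1 := key x hx y hy
  -- `[y,[x,y]]` is linear in `x` and `[x,[x,y]]` quadratic: twice the relation for `x` minus the
  -- relation for `2x` leaves `2 [x,[x,y]]`.
  have h2 := key _ (H.smul_mem (2 : ℝ) hx) y hy
  have h3 := H.smul_mem (2⁻¹ : ℝ) (H.sub_mem (H.smul_mem (2 : ℝ) h1) h2)
  have e : (2⁻¹ : ℝ) • ((2 : ℝ) • (⁅y, ⁅x, y⁆⁆ - ⁅x, ⁅x, y⁆⁆) -
      (⁅y, ⁅(2 : ℝ) • x, y⁆⁆ - ⁅(2 : ℝ) • x, ⁅(2 : ℝ) • x, y⁆⁆)) = ⁅x, ⁅x, y⁆⁆ := by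
    simp only [Ring.lie_def, smul_mul_assoc, mul_smul_comm, ← smul_sub]
    module
  rwa [e] at h3

theorem exp_image_subset_posInv (hH : ∀ x ∈ H, IsSelfAdjoint x) :
    exp '' (H : Set A) ⊆ posInv A := by
  rintro _ ⟨x, hx, rfl⟩
  exact exp_mem_posInv (hH x hx)

end CStar

end PositiveCone

theorem mainTheorem3 {A : Type*} [CStarAlgebra A] [WStarAlgebra A] [PartialOrder A]
    [StarOrderedRing A] (τ : A →ₗ[ℂ] ℂ) (hτ : PositiveCone.IsFiniteNormalFaithfulTrace τ)
    (H : Submodule ℝ A) (hH : ∀ x ∈ H, IsSelfAdjoint x) (hclosed : IsClosed (H : Set A)) :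
    (PositiveCone.IsGeodesicallyConvex (NormedSpace.exp '' (H : Set A)) ↔
      ∀ x ∈ H, ∀ y ∈ H, ⁅x, ⁅x, y⁆⁆ ∈ H) ∧
    (PositiveCone.ContainsCompleteGeodesics (NormedSpace.exp '' (H : Set A)) ↔
      ∀ x ∈ H, ∀ y ∈ H, ⁅x, ⁅x, y⁆⁆ ∈ H) := by
  refine ⟨⟨fun h => ?_, fun h => ?_⟩, ⟨fun h => ?_, fun h => ?_⟩⟩
  · refine (PositiveCone.isLieTripleSystem_of_geometricMeanExp_mem hH hclosed
      fun x hx y hy => ?_).lie_lie_mem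
    -- The geometric mean is by definition the value at time `1/2` of the geodesic supplied here.
    exact h.2 _ ⟨x, hx, rfl⟩ _ ⟨y, hy, rfl⟩ _
      (PositiveCone.isGeodesicOn_geodesic (uniqueDiffOn_Icc one_pos) (hH x hx) .log)
      (PositiveCone.geodesic_zero _ _) (PositiveCone.geodesic_log_one (hH x hx) (hH y hy)) _
      (by norm_num)
  · exact ⟨PositiveCone.exp_image_subset_posInv hH, fun p hp q hq γ hγ h0 h1 t ht =>
      PositiveCone.IsLieTripleSystem.geodesic_mem ⟨hH, hclosed, h⟩ (convex_Icc 0 1)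
        (uniqueDiffOn_Icc one_pos) (by simp) (by simp) hγ (h0 ▸ hp) (h1 ▸ hq) ht⟩
  · refine (PositiveCone.isLieTripleSystem_of_geometricMeanExp_mem hH hclosed
      fun x hx y hy => ?_).lie_lie_mem
    exact h.2 _ ⟨x, hx, rfl⟩ _ ⟨y, hy, rfl⟩ _
      (PositiveCone.isGeodesicOn_geodesic uniqueDiffOn_univ (hH x hx) .log)
      (PositiveCone.geodesic_zero _ _) (PositiveCone.geodesic_log_one (hH x hx) (hH y hy)) _
  · exact ⟨PositiveCone.exp_image_subset_posInv hH, fun p hp q hq γ hγ h0 h1 t =>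
      PositiveCone.IsLieTripleSystem.geodesic_mem ⟨hH, hclosed, h⟩ convex_univ
        uniqueDiffOn_univ trivial trivial hγ (h0 ▸ hp) (h1 ▸ hq) trivial⟩
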